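/- For $d\ge 0$, a measurable $p:\mathbb{R}^d\to[0,\infty)$ is a density if $\int_{\mathbb{R}^d}p\,dx=1$. A function $g:\mathbb{R}^d\to[0,\infty)$ is log-concave if $g=e^{-\varphi}$ for some convex $\varphi:\mathbb{R}^d\to(-\infty,\infty]$. For a (symmetric) positive definite $d\times d$ matrix $\Sigma$ and $\mu\in\mathbb{R}^d$, let $\phi_\Sigma(x)=(2\pi)^{-d/2}(\det\Sigma)^{-1/2}\exp\left(-\tfrac12x^T\Sigma^{-1}x\right)$, and let $SLC_2(\mu,\Sigma,d)$ be the class of densities $p$ on $\mathbb{R}^d$ of the form $p(x)=g(x)\,\phi_\Sigma(x-\mu)$ for all $x\in\mathbb{R}^d$, with $g$ log-concave. Theorem (preservation of strong log-concavity under marginalization). Let $\Sigma=\begin{pmatrix}\Sigma_{11}&\Sigma_{12}\\ \Sigma_{21}&\Sigma_{22}\end{pmatrix}$ be a positive definite $(m+n)\times(m+n)$ matrix, where $\Sigma_{11}$ is $m\times m$ and $\Sigma_{22}$ is $n\times n$, and let $p\in SLC_2(0,\Sigma,m+n)$. Then for every $x\in\mathbb{R}^m$ the function $y\mapsto p(x,y)$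 is integrable on $\mathbb{R}^n$, and the marginal density $q$ on $\mathbb{R}^m$ given by $$q(x)=\int_{\mathbb{R}^n}p(x,y)\,dy$$ is strongly log-concave: $q\in SLC_2(0,\Sigma_{11},m)$. -/

import Mathlib

open MeasureTheory
open scoped Matrix

noncomputable section

/-- `p` is a probability density with respect to Lebesgue measure on `ℝ^ι`. -/
structure IsProbDensity {ι : Type*} [Fintype ι] (p : (ι → ℝ) → ℝ) : Prop where
  measurable : Measurable p
  nonneg : ∀ x, 0 ≤ p x
  integrable : Integrable p volume
  integral_eq_one : ∫ x, p x = 1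

/-- `f = exp (-φ)` for a convex function `φ : ℝ^ι → (-∞, ∞]`. The extended-valued convex function is
given by its effective domain `C` (a convex set) and its finite values on `C`; it is `∞` outside of
`C`, where `f` vanishes. No integrability is required, so constants and Gaussians are included. -/
def IsLogConcave {ι : Type*} (f : (ι → ℝ) → ℝ) : Prop :=
  ∃ (C : Set (ι → ℝ)) (φ : (ι → ℝ) → ℝ),
    ConvexOn ℝ C φ ∧ f = C.indicator (fun x => Real.exp (-φ x))

/-- The density at `x` of the centred normal distribution on `ℝ^ι` with covariance matrix `S`. -/
def gaussianDensity {ι : Type*} [Fintype ι] [DecidableEq ι] (S : Matrix ι ι ℝ) (x : ι → ℝ) : ℝ :=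
  (Real.sqrt ((2 * Real.pi) ^ Fintype.card ι * S.det))⁻¹ *
    Real.exp (-(1 / 2) * (x ⬝ᵥ (S⁻¹ *ᵥ x)))

/-- The class of strongly log-concave densities on `ℝ^ι` with Gaussian parameters `μ`, `S`, where
`S` is positive definite: densities that are a log-concave function times the `N(μ, S)` density. -/
structure IsSLC₂ {ι : Type*} [Fintype ι] [DecidableEq ι] (μ : ι → ℝ) (S : Matrix ι ι ℝ)
    (p : (ι → ℝ) → ℝ) : Prop where
  posDef : S.PosDef
  density : IsProbDensity p
  factor : ∃ g : (ι → ℝ) → ℝ, IsLogConcave g ∧ ∀ x, p x = g x * gaussianDensity S (x - μ)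

end

/-!
The density `p` is `g` times the density of `N(0, S)`. The inverse quadratic form of `S` at `(x, y)`
exceeds that of the block `S₁₁` at `x` by a positive semidefinite form in `(x, y)`
(`Matrix.PosDef.dotProduct_inv_le_of_fromBlocks`), so `p (x, y)` is the density of `N(0, S₁₁)` at
`x` times a function `F (x, y)` that is still log-concave: `g` times the exponential of a concave
quadratic form. Integrating over `y`, the Gaussian factor comes out of the integral, and the
remaining factor, the marginal of `F`, is log-concave by Prékopa's theorem
(`IsLogConcave.marginal`).

Prékopa's theorem is an instance of the Prékopa–Leindler inequality (`prekopaLeindler`). On the line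
that inequality follows from the Brunn–Minkowski inequality for superlevel sets, the layer-cake
formula and the weighted arithmetic-geometric mean inequality; in higher dimension it follows by
induction, splitting off one coordinate. Working with values in `[0, ∞]` spares the induction all
finiteness conditions on the fibre integrals.

Integrability on every fibre, and not merely on almost every one, comes from a pointwise bound
(`IsSLC₂.exists_le_prod_exp`): a log-concave function that is not almost everywhere zero grows at
most exponentially, hence `p` is dominated by a product of one-dimensional Gaussian functions.
-/

/-! ### The Prékopa–Leindler inequality on the line -/

open Set Filter Topology in
/-- The Brunn–Minkowski inequality on the line, for compact sets: the translates of `K` by `min L`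
and of `L` by `max K` lie in `K + L` and share only the point `max K + min L`. -/
theorem volume_add_volume_le_of_isCompact {K L C : Set ℝ} (hK : IsCompact K) (hL : IsCompact L)
    (hK₀ : K.Nonempty) (hL₀ : L.Nonempty) (h : ∀ x ∈ K, ∀ y ∈ L, x + y ∈ C) :
    volume K + volume L ≤ volume C := by
  obtain ⟨k, hk, hkmax⟩ := hK.exists_isGreatest hK₀
  obtain ⟨l, hl, hlmin⟩ := hL.exists_isLeast hL₀
  have hd : AEDisjoint volume ((fun x => x + l) '' K) ((fun y => k + y) '' L) := by
    refine measure_mono_null (t := {k + l}) ?_ (by simp)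
    rintro _ ⟨⟨x, hx, rfl⟩, y, hy, hxy⟩
    have h1 := hkmax hx
    have h2 := hlmin hy
    simp only [mem_singleton_iff] at *
    linarith
  have hLm : MeasurableSet ((fun y => k + y) '' L) :=
    (hL.image (by fun_prop)).measurableSet
  calc volume K + volume L
      = volume ((fun x => x + l) '' K) + volume ((fun y => k + y) '' L) := by
        simp [image_add_right, image_add_left]
    _ = volume ((fun x => x + l) '' K ∪ (fun y => k + y) '' L) :=
        (measure_union₀ hLm.nullMeasurableSet hd).symm
    _ ≤ volume C := by
        apply measure_mono
        rintro _ (⟨x, hx, rfl⟩ | ⟨y, hy, rfl⟩)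
        · exact h _ hx _ hl
        · exact h _ hk _ hy

/-- The Brunn–Minkowski inequality on the line. The set `C` contains the Minkowski sum `A + B` and
is not required to be measurable. -/
theorem volume_add_volume_le {A B C : Set ℝ} (hA : MeasurableSet A) (hB : MeasurableSet B)
    (hA₀ : A.Nonempty) (hB₀ : B.Nonempty) (h : ∀ x ∈ A, ∀ y ∈ B, x + y ∈ C) :
    volume A + volume B ≤ volume C := by
  obtain ⟨x₀, hx₀⟩ := hA₀
  obtain ⟨y₀, hy₀⟩ := hB₀
  have key : ∀ K : Set ℝ, K ⊆ A ∧ IsCompact K → ∀ L : Set ℝ, L ⊆ B ∧ IsCompact L →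
      volume K + volume L ≤ volume C := by
    rintro K ⟨hKA, hK⟩ L ⟨hLB, hL⟩
    refine le_trans (add_le_add (measure_mono (Set.subset_insert x₀ K))
      (measure_mono (Set.subset_insert y₀ L))) ?_
    refine volume_add_volume_le_of_isCompact (hK.insert x₀) (hL.insert y₀)
      (Set.insert_nonempty _ _) (Set.insert_nonempty _ _) fun x hx y hy => ?_
    exact h x (Set.insert_subset hx₀ hKA hx) y (Set.insert_subset hy₀ hLB hy)
  have := ENNReal.biSup_add_biSup_le' (f := fun K : Set ℝ => volume K)
    (g := fun L : Set ℝ => volume L) ⟨∅, Set.empty_subset A, isCompact_empty⟩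
    ⟨∅, Set.empty_subset B, isCompact_empty⟩ key
  rw [hA.measure_eq_iSup_isCompact volume, hB.measure_eq_iSup_isCompact volume]
  simpa only [iSup_and] using this

/-- The Brunn–Minkowski inequality on the line for the combination `a • A + b • B`. -/
theorem ofReal_mul_volume_add_le {A B C : Set ℝ} {a b : ℝ} (ha : 0 < a) (hb : 0 < b)
    (hA : MeasurableSet A) (hB : MeasurableSet B) (hA₀ : A.Nonempty) (hB₀ : B.Nonempty)
    (h : ∀ x ∈ A, ∀ y ∈ B, a * x + b * y ∈ C) :
    ENNReal.ofReal a * volume A + ENNReal.ofReal b * volume B ≤ volume C := by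
  have hs : ∀ {c : ℝ} (S : Set ℝ), 0 < c →
      ENNReal.ofReal c * volume S = volume ((fun x => c * x) '' S) := by
    intro c S hc
    have := Measure.addHaar_smul (volume : Measure ℝ) c S
    rw [Module.finrank_self, pow_one, abs_of_pos hc] at this
    exact this.symm
  have hm : ∀ {c : ℝ} {S : Set ℝ}, 0 < c → MeasurableSet S →
      MeasurableSet ((fun x => c * x) '' S) := fun {c S} hc hS =>
    (Homeomorph.mulLeft₀ c hc.ne').measurableEmbedding.measurableSet_image.2 hS
  rw [hs A ha, hs B hb]
  refine volume_add_volume_le (hm ha hA) (hm hb hB) (hA₀.image _) (hB₀.image _) ?_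
  rintro _ ⟨x, hx, rfl⟩ _ ⟨y, hy, rfl⟩
  exact h x hx y hy

/-- The layer-cake formula for an extended-valued function bounded by `1`. -/
theorem lintegral_eq_lintegral_volume_lt {α : Type*} [MeasurableSpace α] (μ : Measure α)
    {u : α → ENNReal} (hu : Measurable u) (hu₁ : ∀ x, u x ≤ 1) :
    ∫⁻ x, u x ∂μ = ∫⁻ s in Set.Ioi (0 : ℝ), μ {x | ENNReal.ofReal s < u x} := by
  have hfin : ∀ x, u x ≠ ⊤ := fun x => ((hu₁ x).trans_lt ENNReal.one_lt_top).ne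
  have := lintegral_eq_lintegral_meas_lt μ (f := fun x => (u x).toReal)
    (Filter.Eventually.of_forall fun x => ENNReal.toReal_nonneg) hu.ennreal_toReal.aemeasurable
  simp only [ENNReal.ofReal_toReal (hfin _)] at this
  rw [this]
  refine setLIntegral_congr_fun measurableSet_Ioi fun s hs => ?_
  simp only [ENNReal.ofReal_lt_iff_lt_toReal (le_of_lt hs) (hfin _)]

theorem ENNReal.rpow_mul_rpow_le_add {a b : ℝ} (ha : 0 < a) (hb : 0 < b) (hab : a + b = 1)
    (x y : ENNReal) : x ^ a * y ^ b ≤ ENNReal.ofReal a * x + ENNReal.ofReal b * y := by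
  rcases eq_or_ne x ⊤ with rfl | hx
  · simp [ENNReal.mul_top, ha]
  rcases eq_or_ne y ⊤ with rfl | hy
  · simp [ENNReal.mul_top, hb]
  lift x to NNReal using hx
  lift y to NNReal using hy
  have := NNReal.geom_mean_le_arith_mean2_weighted a.toNNReal b.toNNReal x y
    (by rw [← Real.toNNReal_add ha.le hb.le, hab, Real.toNNReal_one])
  rw [Real.coe_toNNReal a ha.le, Real.coe_toNNReal b hb.le] at this
  rw [← ENNReal.coe_rpow_of_nonneg _ ha.le, ← ENNReal.coe_rpow_of_nonneg _ hb.le]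
  simp only [ENNReal.ofReal]
  exact_mod_cast this

/-- The Prékopa–Leindler inequality on the line for functions with supremum `1`: the superlevel sets
at heights in `(0, 1)` are then nonempty, so that Brunn–Minkowski applies at each height. -/
theorem prekopaLeindler_real_of_iSup_eq_one {f g h : ℝ → ENNReal} {a b : ℝ} (ha : 0 < a)
    (hb : 0 < b) (hab : a + b = 1) (hf : Measurable f) (hg : Measurable g) (hh : Measurable h)
    (hf₁ : ⨆ x, f x = 1) (hg₁ : ⨆ x, g x = 1)
    (hfgh : ∀ x y, f x ^ a * g y ^ b ≤ h (a * x + b * y)) :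
    (∫⁻ x, f x) ^ a * (∫⁻ x, g x) ^ b ≤ ∫⁻ x, h x := by
  have hf' : ∀ x, f x ≤ 1 := fun x => hf₁ ▸ le_iSup f x
  have hg' : ∀ x, g x ≤ 1 := fun x => hg₁ ▸ le_iSup g x
  refine (ENNReal.rpow_mul_rpow_le_add ha hb hab _ _).trans ?_
  refine le_trans ?_ (lintegral_mono fun x => min_le_left (h x) 1)
  have mf : Measurable fun s : ℝ => volume {x | ENNReal.ofReal s < f x} :=
    Antitone.measurable fun s t hst => measure_mono fun x hx =>
      (ENNReal.ofReal_le_ofReal hst).trans_lt hx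
  have mg : Measurable fun s : ℝ => volume {x | ENNReal.ofReal s < g x} :=
    Antitone.measurable fun s t hst => measure_mono fun x hx =>
      (ENNReal.ofReal_le_ofReal hst).trans_lt hx
  rw [lintegral_eq_lintegral_volume_lt volume hf hf', lintegral_eq_lintegral_volume_lt volume hg hg',
    lintegral_eq_lintegral_volume_lt volume (hh.min measurable_const) fun x => min_le_right _ _,
    ← lintegral_const_mul _ mf, ← lintegral_const_mul _ mg,
    ← lintegral_add_left (mf.const_mul _)]
  refine setLIntegral_mono' measurableSet_Ioi fun s hs => ?_
  rcases lt_or_ge s 1 with hs₁ | hs₁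
  · have hs₁' : ENNReal.ofReal s < 1 := ENNReal.ofReal_lt_one.2 hs₁
    obtain ⟨x₀, hx₀⟩ := lt_iSup_iff.1 (hf₁ ▸ hs₁')
    obtain ⟨y₀, hy₀⟩ := lt_iSup_iff.1 (hg₁ ▸ hs₁')
    refine ofReal_mul_volume_add_le ha hb (measurableSet_lt measurable_const hf)
      (measurableSet_lt measurable_const hg) ⟨x₀, hx₀⟩ ⟨y₀, hy₀⟩ fun x hx y hy => ?_
    refine lt_min (lt_of_lt_of_le ?_ (hfgh x y)) hs₁'
    calc ENNReal.ofReal s = ENNReal.ofReal s ^ a * ENNReal.ofReal s ^ b := by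
          rw [← ENNReal.rpow_add_of_nonneg _ _ ha.le hb.le, hab, ENNReal.rpow_one]
      _ < f x ^ a * g y ^ b :=
          ENNReal.mul_lt_mul (ENNReal.rpow_lt_rpow hx ha) (ENNReal.rpow_lt_rpow hy hb)
  · have e : ∀ u : ℝ → ENNReal, (∀ x, u x ≤ 1) → {x | ENNReal.ofReal s < u x} = ∅ := by
      intro u hu
      ext x
      simpa using (hu x).trans (ENNReal.one_le_ofReal.2 hs₁)
    simp [e f hf', e g hg']

/-- The Prékopa–Leindler inequality on the line for bounded functions, by rescaling to supremum
`1`. -/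
theorem prekopaLeindler_real_of_bounded {f g h : ℝ → ENNReal} {a b : ℝ} (ha : 0 < a)
    (hb : 0 < b) (hab : a + b = 1) (hf : Measurable f) (hg : Measurable g) (hh : Measurable h)
    (hf₁ : ⨆ x, f x ≠ ⊤) (hg₁ : ⨆ x, g x ≠ ⊤)
    (hfgh : ∀ x y, f x ^ a * g y ^ b ≤ h (a * x + b * y)) :
    (∫⁻ x, f x) ^ a * (∫⁻ x, g x) ^ b ≤ ∫⁻ x, h x := by
  set c := ⨆ x, f x with hc
  set d := ⨆ x, g x with hd
  rcases eq_or_ne c 0 with hc₀ | hc₀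
  · have : f = 0 := by
      ext x
      simpa [← hc, hc₀] using le_iSup f x
    simp [this, ha]
  rcases eq_or_ne d 0 with hd₀ | hd₀
  · have : g = 0 := by
      ext x
      simpa [← hd, hd₀] using le_iSup g x
    simp [this, hb]
  have hca₀ : c ^ a ≠ 0 := by simp [hc₀, hf₁]
  have hcat : c ^ a ≠ ⊤ := ENNReal.rpow_ne_top_of_nonneg ha.le hf₁
  have hdb₀ : d ^ b ≠ 0 := by simp [hd₀, hg₁]
  have hdbt : d ^ b ≠ ⊤ := ENNReal.rpow_ne_top_of_nonneg hb.le hg₁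
  have key := prekopaLeindler_real_of_iSup_eq_one (f := fun x => c⁻¹ * f x)
    (g := fun x => d⁻¹ * g x) (h := fun x => (c ^ a)⁻¹ * (d ^ b)⁻¹ * h x) ha hb hab
    (hf.const_mul _) (hg.const_mul _) (hh.const_mul _)
    (by rw [← ENNReal.mul_iSup, ← hc, ENNReal.inv_mul_cancel hc₀ hf₁])
    (by rw [← ENNReal.mul_iSup, ← hd, ENNReal.inv_mul_cancel hd₀ hg₁])
    (fun x y => by
      rw [ENNReal.mul_rpow_of_nonneg _ _ ha.le, ENNReal.mul_rpow_of_nonneg _ _ hb.le,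
        ENNReal.inv_rpow, ENNReal.inv_rpow, mul_mul_mul_comm]
      gcongr
      exact hfgh x y)
  rw [lintegral_const_mul _ hf, lintegral_const_mul _ hg, lintegral_const_mul _ hh,
    ENNReal.mul_rpow_of_nonneg _ _ ha.le, ENNReal.mul_rpow_of_nonneg _ _ hb.le,
    ENNReal.inv_rpow, ENNReal.inv_rpow, mul_mul_mul_comm] at key
  refine (ENNReal.mul_le_mul_iff_right ?_ ?_).1 key
  · exact mul_ne_zero (ENNReal.inv_ne_zero.2 hcat) (ENNReal.inv_ne_zero.2 hdbt)
  · exact ENNReal.mul_ne_top (ENNReal.inv_ne_top.2 hca₀) (ENNReal.inv_ne_top.2 hdb₀)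

open Filter Topology in
/-- The Prékopa–Leindler inequality on the line, obtained from the bounded case by truncating `f` and
`g` at height `N` and letting `N` tend to infinity. -/
theorem prekopaLeindler_real {f g h : ℝ → ENNReal} {a b : ℝ} (ha : 0 < a)
    (hb : 0 < b) (hab : a + b = 1) (hf : Measurable f) (hg : Measurable g) (hh : Measurable h)
    (hfgh : ∀ x y, f x ^ a * g y ^ b ≤ h (a * x + b * y)) :
    (∫⁻ x, f x) ^ a * (∫⁻ x, g x) ^ b ≤ ∫⁻ x, h x := by
  rcases eq_or_ne (∫⁻ x, f x) 0 with hf₀ | hf₀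
  · simp [hf₀, ha]
  rcases eq_or_ne (∫⁻ x, g x) 0 with hg₀ | hg₀
  · simp [hg₀, hb]
  have hlim : ∀ u : ℝ → ENNReal, Measurable u →
      Tendsto (fun N : ℕ => ∫⁻ x, min (u x) N) atTop (𝓝 (∫⁻ x, u x)) := by
    intro u hu
    refine lintegral_tendsto_of_tendsto_of_monotone
      (fun N => (hu.min measurable_const).aemeasurable)
      (Eventually.of_forall fun x N M hNM => min_le_min le_rfl (by exact_mod_cast hNM))
      (Eventually.of_forall fun x => ?_)
    simpa using tendsto_const_nhds.min ENNReal.tendsto_nat_nhds_top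
  have hbound : ∀ (u : ℝ → ENNReal) (N : ℕ), ⨆ x, min (u x) N ≠ ⊤ := fun u N =>
    ((iSup_le fun x => min_le_right _ _).trans_lt (ENNReal.natCast_lt_top N)).ne
  refine le_of_tendsto (ENNReal.Tendsto.mul ((hlim f hf).ennrpow_const a) ?_
    ((hlim g hg).ennrpow_const b) ?_) (Eventually.of_forall fun N : ℕ => ?_)
  · left; simp [hf₀, ha, ha.not_gt]
  · left; simp [hg₀, hb, hb.not_gt]
  · refine prekopaLeindler_real_of_bounded ha hb hab (hf.min measurable_const)
      (hg.min measurable_const) hh (hbound f N) (hbound g N) fun x y => le_trans ?_ (hfgh x y)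
    gcongr <;> exact min_le_left _ _

/-! ### The Prékopa–Leindler inequality on `ℝⁿ` -/

/-- Tonelli's theorem on `ℝⁿ⁺¹`, with the first coordinate split off. -/
theorem lintegral_fin_succ_eq {n : ℕ} {u : (Fin (n + 1) → ℝ) → ENNReal} (hu : Measurable u) :
    ∫⁻ x, u x = ∫⁻ s : ℝ, ∫⁻ x : Fin n → ℝ, u (Fin.cons s x) := by
  have hmp := (volume_preserving_piFinSuccAbove (fun _ : Fin (n + 1) => ℝ) 0).symm
  rw [← hmp.lintegral_comp hu, Measure.volume_eq_prod,
    lintegral_prod (fun q => u ((MeasurableEquiv.piFinSuccAbove (fun _ => ℝ) 0).symm q))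
      (hu.comp (MeasurableEquiv.measurable _)).aemeasurable]
  simp [MeasurableEquiv.piFinSuccAbove_symm_apply, Fin.insertNthEquiv, Fin.insertNth_zero']

/-- The Prékopa–Leindler inequality, by induction on the dimension: on each pair of hyperplanes the
inequality in one dimension less shows that the fibre integrals satisfy the hypothesis of the
inequality on the line. -/
theorem prekopaLeindler {n : ℕ} {f g h : (Fin n → ℝ) → ENNReal} {a b : ℝ} (ha : 0 < a)
    (hb : 0 < b) (hab : a + b = 1) (hf : Measurable f) (hg : Measurable g) (hh : Measurable h)
    (hfgh : ∀ x y, f x ^ a * g y ^ b ≤ h (a • x + b • y)) :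
    (∫⁻ x, f x) ^ a * (∫⁻ x, g x) ^ b ≤ ∫⁻ x, h x := by
  induction n with
  | zero =>
    have hvol : (volume : Measure (Fin 0 → ℝ)) Set.univ = 1 := by
      rw [volume_pi, Measure.pi_univ]; simp
    simp only [lintegral_unique, hvol, mul_one]
    exact (hfgh _ _).trans_eq (congrArg h (Subsingleton.elim _ _))
  | succ n ih =>
    have hcons : Measurable fun q : ℝ × (Fin n → ℝ) => (Fin.cons q.1 q.2 : Fin (n + 1) → ℝ) := by
      refine measurable_pi_iff.2 fun i => ?_
      refine Fin.cases ?_ (fun j => ?_) i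
      · simpa using measurable_fst
      · simpa [Function.comp_def] using (measurable_pi_apply j).comp measurable_snd
    have hm : ∀ {u : (Fin (n + 1) → ℝ) → ENNReal}, Measurable u →
        Measurable fun s : ℝ => ∫⁻ x : Fin n → ℝ, u (Fin.cons s x) := fun hu =>
      (hu.comp hcons).lintegral_prod_right'
    have hm' : ∀ {u : (Fin (n + 1) → ℝ) → ENNReal} (s : ℝ), Measurable u →
        Measurable fun x : Fin n → ℝ => u (Fin.cons s x) := fun s hu =>
      (hu.comp hcons).comp measurable_prodMk_left
    rw [lintegral_fin_succ_eq hf, lintegral_fin_succ_eq hg, lintegral_fin_succ_eq hh]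
    refine prekopaLeindler_real ha hb hab (hm hf) (hm hg) (hm hh) fun s t => ?_
    refine ih (hm' s hf) (hm' t hg) (hm' _ hh) fun x y => ?_
    refine (hfgh (Fin.cons s x) (Fin.cons t y)).trans_eq (congrArg h ?_)
    ext i
    refine Fin.cases ?_ (fun j => ?_) i <;> simp

/-! ### Log-concave functions -/

/-- Log-concavity as a multiplicative inequality. Zeros of `f` need no separate treatment, since
`0 ^ s = 0` for `s > 0`. -/
theorem isLogConcave_iff {ι : Type*} {f : (ι → ℝ) → ℝ} :
    IsLogConcave f ↔ (∀ x, 0 ≤ f x) ∧ ∀ x y (s t : ℝ), 0 < s → 0 < t → s + t = 1 →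
      f x ^ s * f y ^ t ≤ f (s • x + t • y) := by
  constructor
  · rintro ⟨C, φ, hφ, rfl⟩
    have h₀ : ∀ x, 0 ≤ C.indicator (fun x => Real.exp (-φ x)) x := fun x =>
      Set.indicator_nonneg (fun _ _ => (Real.exp_pos _).le) x
    refine ⟨h₀, fun x y s t hs ht hst => ?_⟩
    by_cases hx : x ∈ C
    · by_cases hy : y ∈ C
      · rw [Set.indicator_of_mem hx, Set.indicator_of_mem hy,
          Set.indicator_of_mem (hφ.1 hx hy hs.le ht.le hst), ← Real.exp_mul, ← Real.exp_mul,
          ← Real.exp_add, Real.exp_le_exp]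
        have := hφ.2 hx hy hs.le ht.le hst
        simp only [smul_eq_mul] at this
        linarith
      · rw [Set.indicator_of_notMem hy, Real.zero_rpow ht.ne', mul_zero]
        exact h₀ _
    · rw [Set.indicator_of_notMem hx, Real.zero_rpow hs.ne', zero_mul]
      exact h₀ _
  · rintro ⟨h₀, h⟩
    have hpos : ∀ ⦃x y⦄ {s t : ℝ}, 0 < f x → 0 < f y → 0 < f x ^ s * f y ^ t := fun x y s t hx hy =>
      mul_pos (Real.rpow_pos_of_pos hx _) (Real.rpow_pos_of_pos hy _)
    refine ⟨{x | 0 < f x}, fun x => -Real.log (f x), convexOn_iff_forall_pos.2 ⟨?_, ?_⟩, ?_⟩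
    · exact convex_iff_forall_pos.2 fun x hx y hy s t hs ht hst =>
        (hpos hx hy).trans_le (h x y s t hs ht hst)
    · intro x hx y hy s t hs ht hst
      have hx' : 0 < f x := hx
      have hy' : 0 < f y := hy
      have := Real.log_le_log (hpos hx hy) (h x y s t hs ht hst)
      rw [Real.log_mul (Real.rpow_pos_of_pos hx' _).ne' (Real.rpow_pos_of_pos hy' _).ne',
        Real.log_rpow hx', Real.log_rpow hy'] at this
      simp only [smul_eq_mul]
      linarith
    · ext x
      rcases (h₀ x).eq_or_lt with hx | hx
      · rw [Set.indicator_of_notMem (by simp [← hx]), hx]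
      · rw [Set.indicator_of_mem (by exact hx), neg_neg, Real.exp_log hx]

theorem IsLogConcave.mul {ι : Type*} {f g : (ι → ℝ) → ℝ} (hf : IsLogConcave f)
    (hg : IsLogConcave g) : IsLogConcave fun x => f x * g x := by
  rw [isLogConcave_iff] at hf hg ⊢
  refine ⟨fun x => mul_nonneg (hf.1 x) (hg.1 x), fun x y s t hs ht hst => ?_⟩
  rw [Real.mul_rpow (hf.1 x) (hg.1 x), Real.mul_rpow (hf.1 y) (hg.1 y), mul_mul_mul_comm]
  exact mul_le_mul (hf.2 x y s t hs ht hst) (hg.2 x y s t hs ht hst)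
    (mul_nonneg (Real.rpow_nonneg (hg.1 x) _) (Real.rpow_nonneg (hg.1 y) _)) (hf.1 _)

theorem ConvexOn.isLogConcave_exp_neg {ι : Type*} {φ : (ι → ℝ) → ℝ}
    (hφ : ConvexOn ℝ Set.univ φ) : IsLogConcave fun x => Real.exp (-φ x) :=
  ⟨Set.univ, φ, hφ, (Set.indicator_univ _).symm⟩

theorem isLogConcave_const {ι : Type*} {c : ℝ} (hc : 0 < c) :
    IsLogConcave fun _ : ι → ℝ => c := by
  simpa [Real.exp_log hc] using
    (convexOn_const (-Real.log c) (convex_univ (𝕜 := ℝ) (E := ι → ℝ))).isLogConcave_exp_neg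

theorem sum_elim_smul_add_smul {ι κ : Type*} (s t : ℝ) (x x' : ι → ℝ) (y y' : κ → ℝ) :
    Sum.elim (s • x + t • x') (s • y + t • y') = s • Sum.elim x y + t • Sum.elim x' y' := by
  ext (i | i) <;> simp

theorem measurable_sum_elim {ι κ : Type*} :
    Measurable fun q : (ι → ℝ) × (κ → ℝ) => Sum.elim q.1 q.2 := by
  refine measurable_pi_iff.2 ?_
  rintro (i | i)
  · exact (measurable_pi_apply i).comp measurable_fst
  · exact (measurable_pi_apply i).comp measurable_snd

/-- Prékopa's theorem: a marginal of a log-concave function is log-concave. It is the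
Prékopa–Leindler inequality applied to three fibres. -/
theorem IsLogConcave.marginal {ι : Type*} {n : ℕ} {F : (ι ⊕ Fin n → ℝ) → ℝ}
    (hF : IsLogConcave F) (hm : Measurable F)
    (hi : ∀ x : ι → ℝ, Integrable fun y : Fin n → ℝ => F (Sum.elim x y)) :
    IsLogConcave fun x : ι → ℝ => ∫ y : Fin n → ℝ, F (Sum.elim x y) := by
  rw [isLogConcave_iff] at hF ⊢
  have h₀ : ∀ x : ι → ℝ, 0 ≤ ∫ y : Fin n → ℝ, F (Sum.elim x y) := fun x =>
    integral_nonneg fun y => hF.1 _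
  refine ⟨h₀, fun x x' s t hs ht hst => ?_⟩
  have hfib : ∀ x : ι → ℝ, Measurable fun y : Fin n → ℝ => ENNReal.ofReal (F (Sum.elim x y)) :=
    fun x => (hm.comp (measurable_sum_elim.comp measurable_prodMk_left)).ennreal_ofReal
  have key := prekopaLeindler hs ht hst (hfib x) (hfib x') (hfib (s • x + t • x')) fun y y' => by
    rw [ENNReal.ofReal_rpow_of_nonneg (hF.1 _) hs.le, ENNReal.ofReal_rpow_of_nonneg (hF.1 _) ht.le,
      ← ENNReal.ofReal_mul (Real.rpow_nonneg (hF.1 _) _), sum_elim_smul_add_smul]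
    exact ENNReal.ofReal_le_ofReal (hF.2 _ _ s t hs ht hst)
  have he : ∀ x : ι → ℝ, ∫⁻ y : Fin n → ℝ, ENNReal.ofReal (F (Sum.elim x y)) =
      ENNReal.ofReal (∫ y : Fin n → ℝ, F (Sum.elim x y)) := fun x =>
    (ofReal_integral_eq_lintegral_ofReal (hi x) (Filter.Eventually.of_forall fun y => hF.1 _)).symm
  rw [he, he, he, ENNReal.ofReal_rpow_of_nonneg (h₀ _) hs.le,
    ENNReal.ofReal_rpow_of_nonneg (h₀ _) ht.le,
    ← ENNReal.ofReal_mul (Real.rpow_nonneg (h₀ _) _)] at key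
  exact (ENNReal.ofReal_le_ofReal_iff (h₀ _)).1 key

/-- A log-concave function that is positive on a set of positive measure grows at most
exponentially: its exponent is bounded near an interior point `x₀` of the effective domain, and
convexity along the line from a point `x` through `x₀` turns this into a bound at `x`. -/
theorem IsLogConcave.exists_le_exp {ι : Type*} [Fintype ι] {g : (ι → ℝ) → ℝ}
    (hg : IsLogConcave g) (hpos : volume {x | g x ≠ 0} ≠ 0) :
    ∃ c L : ℝ, ∀ x, g x ≤ Real.exp (c + L * ‖x‖) := by
  obtain ⟨C, φ, hφ, rfl⟩ := hg
  have hint : (interior C).Nonempty := by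
    by_contra hne
    rw [Set.not_nonempty_iff_eq_empty] at hne
    refine hpos (measure_mono_null (fun x hx => ?_) (hφ.1.addHaar_frontier volume))
    rw [frontier, hne, Set.sdiff_empty]
    exact subset_closure (Set.mem_of_indicator_ne_zero hx)
  obtain ⟨x₀, hx₀⟩ := hint
  have hev : ∀ᶠ z in nhds x₀, z ∈ C ∧ φ z < φ x₀ + 1 :=
    Filter.Eventually.and (mem_interior_iff_mem_nhds.1 hx₀)
      ((hφ.continuousOn_interior.continuousAt (isOpen_interior.mem_nhds hx₀)).eventually
        (gt_mem_nhds (lt_add_one _)))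
  obtain ⟨r, hr, hball⟩ := Metric.nhds_basis_closedBall.eventually_iff.1 hev
  refine ⟨-φ x₀ + (1 + ‖x₀‖) / r, r⁻¹, fun x => ?_⟩
  by_cases hx : x ∈ C
  swap
  · rw [Set.indicator_of_notMem hx]
    exact (Real.exp_pos _).le
  rw [Set.indicator_of_mem hx, Real.exp_le_exp]
  set ρ := ‖x - x₀‖ with hρ
  have hρ₀ : 0 ≤ ρ := norm_nonneg _
  have hρ₁ : 0 < 1 + ρ := by positivity
  -- `x₀` is the convex combination of `x` and a point `z` of the ball with weights
  -- `r / (1 + ρ + r)` and `(1 + ρ) / (1 + ρ + r)`.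
  set z := x₀ - (r / (1 + ρ)) • (x - x₀) with hz
  have hzball : z ∈ Metric.closedBall x₀ r := by
    rw [mem_closedBall_iff_norm, hz, sub_sub_cancel_left, norm_neg, norm_smul, ← hρ,
      Real.norm_of_nonneg (by positivity), div_mul_eq_mul_div, div_le_iff₀ hρ₁]
    nlinarith
  obtain ⟨hzC, hzφ⟩ := hball hzball
  have hcomb : (r / (1 + ρ + r)) • x + ((1 + ρ) / (1 + ρ + r)) • z = x₀ := by
    ext i
    simp only [hz, Pi.add_apply, Pi.smul_apply, Pi.sub_apply, smul_eq_mul]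
    field_simp
    ring
  have hw₁ : 0 ≤ r / (1 + ρ + r) := by positivity
  have hw₂ : 0 ≤ (1 + ρ) / (1 + ρ + r) := by positivity
  have hw : r / (1 + ρ + r) + (1 + ρ) / (1 + ρ + r) = 1 := by field_simp; ring
  have hconv := hφ.2 hx hzC hw₁ hw₂ hw
  rw [hcomb, smul_eq_mul, smul_eq_mul, div_mul_eq_mul_div, div_mul_eq_mul_div, ← add_div,
    le_div_iff₀ (by positivity)] at hconv
  have h1 : r * (-φ x) ≤ r * -φ x₀ + (1 + ρ) := by nlinarith
  have h2 : ρ ≤ ‖x‖ + ‖x₀‖ := norm_sub_le _ _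
  have h3 : -φ x₀ + (1 + ‖x₀‖) / r + r⁻¹ * ‖x‖ = (r * -φ x₀ + (1 + (‖x‖ + ‖x₀‖))) / r := by
    field_simp
    ring
  rw [h3, le_div_iff₀ hr]
  linarith

/-! ### Quadratic forms -/

theorem convexOn_dotProduct_mulVec {ι : Type*} [Fintype ι] {M : Matrix ι ι ℝ}
    (hM : ∀ z, 0 ≤ z ⬝ᵥ (M *ᵥ z)) : ConvexOn ℝ Set.univ fun z => z ⬝ᵥ (M *ᵥ z) := by
  refine ⟨convex_univ, fun x _ y _ s t hs ht hst => ?_⟩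
  have h := mul_nonneg (mul_nonneg hs ht) (hM (x - y))
  obtain rfl : t = 1 - s := by linarith
  simp only [Matrix.mulVec_add, Matrix.mulVec_sub, Matrix.mulVec_smul, dotProduct_add,
    dotProduct_sub, add_dotProduct, sub_dotProduct, smul_dotProduct, dotProduct_smul,
    smul_eq_mul] at h ⊢
  linarith

/-- Young's inequality for the quadratic forms of `S` and `S⁻¹`, which are conjugate to each
other; it expands the positivity of `S⁻¹` at `z - S v`. -/
theorem Matrix.PosDef.two_mul_dotProduct_le {ι : Type*} [Fintype ι] [DecidableEq ι]
    {S : Matrix ι ι ℝ} (hS : S.PosDef) (v z : ι → ℝ) :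
    2 * (v ⬝ᵥ z) ≤ v ⬝ᵥ (S *ᵥ v) + z ⬝ᵥ (S⁻¹ *ᵥ z) := by
  have h := hS.inv.posSemidef.dotProduct_mulVec_nonneg (z - S *ᵥ v)
  have hdet : IsUnit S.det := hS.det_pos.ne'.isUnit
  have hsymm : Sᵀ = S := by simpa using hS.isHermitian.eq
  have h1 : S⁻¹ *ᵥ (S *ᵥ v) = v := by
    rw [Matrix.mulVec_mulVec, Matrix.nonsing_inv_mul _ hdet, Matrix.one_mulVec]
  have h2 : (S *ᵥ v) ⬝ᵥ (S⁻¹ *ᵥ z) = v ⬝ᵥ z := by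
    rw [Matrix.dotProduct_mulVec, Matrix.vecMul_mulVec, hsymm, Matrix.mul_nonsing_inv _ hdet,
      Matrix.vecMul_one]
  simp only [star_trivial, Matrix.mulVec_sub, dotProduct_sub, sub_dotProduct, h1, h2,
    dotProduct_comm z v, dotProduct_comm (S *ᵥ v) v] at h
  linarith

theorem Matrix.PosDef.sq_le_mul_dotProduct_inv {ι : Type*} [Fintype ι] [DecidableEq ι]
    {S : Matrix ι ι ℝ} (hS : S.PosDef) (z : ι → ℝ) (i : ι) :
    z i ^ 2 ≤ S i i * (z ⬝ᵥ (S⁻¹ *ᵥ z)) := by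
  have hi : 0 < S i i := hS.diag_pos
  have h := hS.two_mul_dotProduct_le (Pi.single i (z i / S i i)) z
  rw [single_dotProduct, single_dotProduct, Matrix.mulVec_single] at h
  simp only [Pi.smul_apply, Matrix.col_apply, MulOpposite.smul_eq_mul_unop, MulOpposite.unop_op] at h
  have h2 : z i / S i i * z i ≤ z ⬝ᵥ (S⁻¹ *ᵥ z) := by
    have : z i / S i i * (S i i * (z i / S i i)) = z i / S i i * z i := by field_simp
    linarith
  calc z i ^ 2 = S i i * (z i / S i i * z i) := by field_simp
    _ ≤ _ := mul_le_mul_of_nonneg_left h2 hi.le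

theorem Matrix.PosDef.sum_sq_le_trace_mul {ι : Type*} [Fintype ι] [DecidableEq ι]
    {S : Matrix ι ι ℝ} (hS : S.PosDef) (z : ι → ℝ) :
    ∑ i, z i ^ 2 ≤ S.trace * (z ⬝ᵥ (S⁻¹ *ᵥ z)) := by
  rw [Matrix.trace, Finset.sum_mul]
  exact Finset.sum_le_sum fun i _ => hS.sq_le_mul_dotProduct_inv z i

theorem Matrix.PosDef.of_fromBlocks₁₁ {m n : Type*} [Finite m] [Finite n]
    {A : Matrix m m ℝ} {B : Matrix m n ℝ} {C : Matrix n m ℝ} {D : Matrix n n ℝ}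
    (h : (Matrix.fromBlocks A B C D).PosDef) : A.PosDef := by
  have := h.submatrix (e := Sum.inl) Sum.inl_injective
  rwa [show (Matrix.fromBlocks A B C D).submatrix Sum.inl Sum.inl = A from rfl] at this

/-- Passing to a diagonal block can only decrease the inverse quadratic form: this is Young's
inequality at the vector `(A⁻¹ x, 0)`. -/
theorem Matrix.PosDef.dotProduct_inv_le_of_fromBlocks {m n : Type*} [Fintype m] [Fintype n]
    [DecidableEq m] [DecidableEq n]
    {A : Matrix m m ℝ} {B : Matrix m n ℝ} {C : Matrix n m ℝ} {D : Matrix n n ℝ}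
    (h : (Matrix.fromBlocks A B C D).PosDef) (x : m → ℝ) (y : n → ℝ) :
    x ⬝ᵥ (A⁻¹ *ᵥ x) ≤ Sum.elim x y ⬝ᵥ ((Matrix.fromBlocks A B C D)⁻¹ *ᵥ Sum.elim x y) := by
  have hA := h.of_fromBlocks₁₁
  have key := h.two_mul_dotProduct_le (Sum.elim (A⁻¹ *ᵥ x) 0) (Sum.elim x y)
  have h1 : A *ᵥ (A⁻¹ *ᵥ x) = x := by
    rw [Matrix.mulVec_mulVec, Matrix.mul_nonsing_inv _ hA.det_pos.ne'.isUnit, Matrix.one_mulVec]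
  rw [Matrix.fromBlocks_mulVec] at key
  simp only [sumElim_dotProduct_sumElim, Sum.elim_comp_inl, Sum.elim_comp_inr, Matrix.mulVec_zero,
    add_zero, h1, zero_dotProduct, dotProduct_comm (A⁻¹ *ᵥ x) x] at key
  linarith

/-! ### Strongly log-concave densities -/

theorem gaussianDensity_pos {ι : Type*} [Fintype ι] [DecidableEq ι] {S : Matrix ι ι ℝ}
    (hS : S.PosDef) (x : ι → ℝ) : 0 < gaussianDensity S x := by
  have := hS.det_pos
  unfold gaussianDensity
  positivity

theorem continuous_gaussianDensity {ι : Type*} [Fintype ι] [DecidableEq ι] (S : Matrix ι ι ℝ) :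
    Continuous (gaussianDensity S) := by
  unfold gaussianDensity
  fun_prop

theorem pi_norm_sq_le_sum_sq {ι : Type*} [Fintype ι] (x : ι → ℝ) : ‖x‖ ^ 2 ≤ ∑ i, x i ^ 2 := by
  have h₀ : 0 ≤ ∑ i, x i ^ 2 := Finset.sum_nonneg fun i _ => sq_nonneg _
  rw [← Real.le_sqrt (norm_nonneg x) h₀, pi_norm_le_iff_of_nonneg (Real.sqrt_nonneg _)]
  exact fun i => Real.abs_le_sqrt
    (Finset.single_le_sum (f := fun i => x i ^ 2) (fun i _ => sq_nonneg _) (Finset.mem_univ i))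

/-- A strongly log-concave density is dominated pointwise by a product of one-dimensional Gaussian
functions: the log-concave factor grows at most exponentially, which half of the Gaussian exponent
absorbs. -/
theorem IsSLC₂.exists_le_prod_exp {ι : Type*} [Fintype ι] [DecidableEq ι] {S : Matrix ι ι ℝ}
    {p : (ι → ℝ) → ℝ} (hp : IsSLC₂ 0 S p) :
    ∃ K b : ℝ, 0 < b ∧ ∀ z, p z ≤ K * ∏ i, Real.exp (-b * z i ^ 2) := by
  obtain ⟨g, hg, hpg⟩ := hp.factor
  have hS := hp.posDef
  have hpos : volume {x | g x ≠ 0} ≠ 0 := by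
    intro h
    have h0 : p =ᵐ[volume] 0 := by
      have : ∀ᵐ x, g x = 0 := h
      filter_upwards [this] with x hx
      simp [hpg, hx]
    have := hp.density.integral_eq_one
    rw [integral_congr_ae h0] at this
    simp at this
  obtain ⟨c, L, hcL⟩ := hg.exists_le_exp hpos
  have htr : 0 ≤ S.trace := hS.posSemidef.trace_nonneg
  -- This `b` makes half of the quadratic form of `S⁻¹` at least `2 * b * ∑ i, z i ^ 2`.
  set b : ℝ := (4 * (S.trace + 1))⁻¹ with hb
  have hb₀ : 0 < b := by positivity
  set k := (Real.sqrt ((2 * Real.pi) ^ Fintype.card ι * S.det))⁻¹ with hk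
  have hk₀ : 0 ≤ k := by positivity
  refine ⟨k * Real.exp (c + L ^ 2 / (4 * b)), b, hb₀, fun z => ?_⟩
  have hQ₀ : 0 ≤ z ⬝ᵥ (S⁻¹ *ᵥ z) := by
    simpa using hS.inv.posSemidef.dotProduct_mulVec_nonneg z
  have hQ : 4 * b * ∑ i, z i ^ 2 ≤ z ⬝ᵥ (S⁻¹ *ᵥ z) := by
    have h4 : 4 * b = (S.trace + 1)⁻¹ := by rw [hb]; field_simp
    rw [h4, inv_mul_le_iff₀ (by positivity)]
    linarith [hS.sum_sq_le_trace_mul z]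
  have hL : L * ‖z‖ ≤ b * ‖z‖ ^ 2 + L ^ 2 / (4 * b) := by
    have h : b * ‖z‖ ^ 2 + L ^ 2 / (4 * b) - L * ‖z‖ = b * (‖z‖ - L / (2 * b)) ^ 2 := by
      field_simp
      ring
    have : 0 ≤ b * (‖z‖ - L / (2 * b)) ^ 2 := by positivity
    linarith
  have hn := mul_le_mul_of_nonneg_left (pi_norm_sq_le_sum_sq z) hb₀.le
  rw [hpg, gaussianDensity, sub_zero, ← hk, ← Real.exp_sum, ← Finset.mul_sum]
  calc g z * (k * Real.exp (-(1 / 2) * (z ⬝ᵥ (S⁻¹ *ᵥ z))))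
      ≤ Real.exp (c + L * ‖z‖) * (k * Real.exp (-(1 / 2) * (z ⬝ᵥ (S⁻¹ *ᵥ z)))) :=
        mul_le_mul_of_nonneg_right (hcL z) (mul_nonneg hk₀ (Real.exp_pos _).le)
    _ = k * Real.exp (c + L * ‖z‖ + -(1 / 2) * (z ⬝ᵥ (S⁻¹ *ᵥ z))) := by
        rw [Real.exp_add (c + L * ‖z‖)]; ring
    _ ≤ k * Real.exp (c + L ^ 2 / (4 * b) + -b * ∑ i, z i ^ 2) := by
        refine mul_le_mul_of_nonneg_left (Real.exp_le_exp.2 ?_) hk₀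
        linarith
    _ = k * Real.exp (c + L ^ 2 / (4 * b)) * Real.exp (-b * ∑ i, z i ^ 2) := by
        rw [Real.exp_add (c + L ^ 2 / (4 * b))]; ring

theorem IsSLC₂.integrable_fibre {ι κ : Type*} [Fintype ι] [DecidableEq ι] [Fintype κ]
    [DecidableEq κ] {S : Matrix (ι ⊕ κ) (ι ⊕ κ) ℝ} {p : (ι ⊕ κ → ℝ) → ℝ} (hp : IsSLC₂ 0 S p)
    (x : ι → ℝ) : Integrable fun y : κ → ℝ => p (Sum.elim x y) := by
  obtain ⟨K, b, hb, hle⟩ := hp.exists_le_prod_exp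
  have hprod : Integrable fun y : κ → ℝ => ∏ i, Real.exp (-b * y i ^ 2) :=
    Integrable.fintype_prod (f := fun _ s => Real.exp (-b * s ^ 2)) fun _ =>
      integrable_exp_neg_mul_sq hb
  refine (hprod.const_mul (K * ∏ i, Real.exp (-b * x i ^ 2))).mono'
    (hp.density.measurable.comp
      (measurable_sum_elim.comp measurable_prodMk_left)).aestronglyMeasurable
    (Filter.Eventually.of_forall fun y => ?_)
  rw [Real.norm_of_nonneg (hp.density.nonneg _)]
  refine (hle _).trans_eq ?_
  simp only [Fintype.prod_sum_type, Sum.elim_inl, Sum.elim_inr, mul_assoc]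

theorem measurePreserving_sum_elim {ι κ : Type*} [Fintype ι] [Fintype κ] :
    MeasurePreserving (fun q : (ι → ℝ) × (κ → ℝ) => Sum.elim q.1 q.2) volume volume := by
  convert (volume_measurePreserving_sumPiEquivProdPi (fun _ : ι ⊕ κ => ℝ)).symm using 2 with q
  ext (i | i) <;> rfl

theorem IsProbDensity.marginal {ι κ : Type*} [Fintype ι] [Fintype κ] {p : (ι ⊕ κ → ℝ) → ℝ}
    (hp : IsProbDensity p) :
    IsProbDensity fun x : ι → ℝ => ∫ y : κ → ℝ, p (Sum.elim x y) := by
  have hm : Measurable fun q : (ι → ℝ) × (κ → ℝ) => p (Sum.elim q.1 q.2) :=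
    hp.measurable.comp measurable_sum_elim
  have hi : Integrable (fun q : (ι → ℝ) × (κ → ℝ) => p (Sum.elim q.1 q.2))
      (volume.prod volume) :=
    measurePreserving_sum_elim.integrable_comp_of_integrable hp.integrable
  refine ⟨hm.stronglyMeasurable.integral_prod_right'.measurable,
    fun x => integral_nonneg fun y => hp.nonneg _, hi.integral_prod_left, ?_⟩
  rw [← integral_prod _ hi, ← hp.integral_eq_one, ← Measure.volume_eq_prod,
    ← measurePreserving_sum_elim.map_eq, integral_map measurable_sum_elim.aemeasurable
    hp.measurable.aestronglyMeasurable]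

theorem mainTheorem6 (m n : ℕ)
    (S₁₁ : Matrix (Fin m) (Fin m) ℝ) (S₁₂ : Matrix (Fin m) (Fin n) ℝ)
    (S₂₁ : Matrix (Fin n) (Fin m) ℝ) (S₂₂ : Matrix (Fin n) (Fin n) ℝ)
    (p : (Fin m ⊕ Fin n → ℝ) → ℝ)
    (hp : IsSLC₂ 0 (Matrix.fromBlocks S₁₁ S₁₂ S₂₁ S₂₂) p) :
    (∀ x : Fin m → ℝ, Integrable (fun y : Fin n → ℝ => p (Sum.elim x y)) volume) ∧
      IsSLC₂ 0 S₁₁ (fun x : Fin m → ℝ => ∫ y : Fin n → ℝ, p (Sum.elim x y)) := by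
  have hfib := hp.integrable_fibre
  refine ⟨hfib, hp.posDef.of_fromBlocks₁₁, hp.density.marginal, ?_⟩
  obtain ⟨g, hg, hpg⟩ := hp.factor
  have hS := hp.posDef
  have hA := hS.of_fromBlocks₁₁
  set S := Matrix.fromBlocks S₁₁ S₁₂ S₂₁ S₂₂ with hSdef
  -- The quadratic form of `M` is the excess of that of `S⁻¹` at `(x, y)` over that of `S₁₁⁻¹` at
  -- `x`; with this `M`, the function `F` below is `p (x, y) / gaussianDensity S₁₁ x`.
  set M : Matrix (Fin m ⊕ Fin n) (Fin m ⊕ Fin n) ℝ := S⁻¹ - Matrix.fromBlocks S₁₁⁻¹ 0 0 0 with hM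
  have hMform : ∀ (x : Fin m → ℝ) (y : Fin n → ℝ), Sum.elim x y ⬝ᵥ (M *ᵥ Sum.elim x y) =
      Sum.elim x y ⬝ᵥ (S⁻¹ *ᵥ Sum.elim x y) - x ⬝ᵥ (S₁₁⁻¹ *ᵥ x) := by
    intro x y
    rw [hM, Matrix.sub_mulVec, dotProduct_sub, Matrix.fromBlocks_mulVec]
    simp [sumElim_dotProduct_sumElim]
  have hMnonneg : ∀ z, 0 ≤ z ⬝ᵥ (M *ᵥ z) := by
    intro z
    rw [← Sum.elim_comp_inl_inr z, hMform]
    exact sub_nonneg.2 (hS.dotProduct_inv_le_of_fromBlocks _ _)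
  have hk : 0 < (Real.sqrt ((2 * Real.pi) ^ Fintype.card (Fin m ⊕ Fin n) * S.det))⁻¹ := by
    have := hS.det_pos
    positivity
  have hk₁ : 0 < (Real.sqrt ((2 * Real.pi) ^ Fintype.card (Fin m) * S₁₁.det))⁻¹ := by
    have := hA.det_pos
    positivity
  set k := (Real.sqrt ((2 * Real.pi) ^ Fintype.card (Fin m ⊕ Fin n) * S.det))⁻¹ with hkdef
  set k₁ := (Real.sqrt ((2 * Real.pi) ^ Fintype.card (Fin m) * S₁₁.det))⁻¹ with hk₁def
  have hconv : ConvexOn ℝ Set.univ fun z => (1 / 2 : ℝ) • (z ⬝ᵥ (M *ᵥ z)) :=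
    (convexOn_dotProduct_mulVec hMnonneg).smul (by norm_num)
  set F : (Fin m ⊕ Fin n → ℝ) → ℝ := fun z =>
    k / k₁ * (g z * Real.exp (-((1 / 2 : ℝ) • (z ⬝ᵥ (M *ᵥ z))))) with hFdef
  have hF : IsLogConcave F :=
    (isLogConcave_const (div_pos hk hk₁)).mul (hg.mul hconv.isLogConcave_exp_neg)
  have hgm : Measurable g := by
    have : g = fun z => p z / gaussianDensity S z := by
      ext z
      rw [hpg, sub_zero, mul_div_cancel_right₀ _ (gaussianDensity_pos hS z).ne']
    rw [this]
    exact hp.density.measurable.div (continuous_gaussianDensity S).measurable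
  have hFm : Measurable F := by
    refine (hgm.mul (Continuous.measurable ?_)).const_mul _
    fun_prop
  have hpF : ∀ x y, p (Sum.elim x y) = F (Sum.elim x y) * gaussianDensity S₁₁ x := by
    intro x y
    rw [hpg, sub_zero, hFdef, gaussianDensity, gaussianDensity, ← hkdef, ← hk₁def]
    simp only [smul_eq_mul, hMform]
    have : Real.exp (-(1 / 2) * (Sum.elim x y ⬝ᵥ (S⁻¹ *ᵥ Sum.elim x y))) =
        Real.exp (-(1 / 2 * (Sum.elim x y ⬝ᵥ (S⁻¹ *ᵥ Sum.elim x y) - x ⬝ᵥ (S₁₁⁻¹ *ᵥ x)))) *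
          Real.exp (-(1 / 2) * (x ⬝ᵥ (S₁₁⁻¹ *ᵥ x))) := by
      rw [← Real.exp_add]
      ring_nf
    rw [this]
    field_simp
  refine ⟨_, hF.marginal hFm fun x => ?_, fun x => ?_⟩
  · have hne := (gaussianDensity_pos hA x).ne'
    refine ((hfib x).div_const (gaussianDensity S₁₁ x)).congr
      (Filter.Eventually.of_forall fun y => ?_)
    simp only [hpF, mul_div_cancel_right₀ _ hne]
  · simp only [sub_zero, hpF]
    exact integral_mul_const _ _
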